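/- Theorem 2.17. Let $R$ be a (not necessarily commutative) ring with identity; all modules are unital right $R$-modules. For a module $M$ let $$Z(M)=\{m\in M : mI=0 \text{ for some essential right ideal } I \text{ of } R\}$$ be its singular submodule, where a right ideal is essential if it has nonzero intersection with every nonzero right ideal. Let the Goldie torsion submodule $Z_2(M)$ be the submodule of $M$ containing $Z(M)$ such that $Z_2(M)/Z(M)=Z(M/Z(M))$. The module $M$ is called Goldie Rickart if $f^{-1}(Z_2(M))$ is a direct summand of $M$ for every $f\in\operatorname{End}_R(M)$. Then the following are equivalent: 1. every $R$-module $M$ is Goldie Rickart and its Goldie torsion submodule $Z_2(M)$ is projective; 2. $R$ is semisimple. -/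

import Mathlib

/-!
Right `R`-modules are modules over the opposite ring `Rᵐᵒᵖ`: the product `m r` is
`MulOpposite.op r • m`.  Right ideals of `R` are the `Rᵐᵒᵖ`-submodules of `R`.
-/

universe u v

namespace GoldieRickart

section Essential

variable {A : Type u} [Ring A] {M : Type v} [AddCommGroup M] [Module A M]

/-- A submodule is essential if it meets every nonzero submodule nontrivially. -/
def IsEssential (N : Submodule A M) : Prop :=
  ∀ L : Submodule A M, N ⊓ L = ⊥ → L = ⊥

theorem isEssential_top : IsEssential (⊤ : Submodule A M) := fun L h => by simpa using h

theorem IsEssential.inf {N K : Submodule A M} (hN : IsEssential N) (hK : IsEssential K) :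
    IsEssential (N ⊓ K) := fun L h => hK L (hN (K ⊓ L) (by rw [← inf_assoc, h]))

theorem IsEssential.comap {M' : Type*} [AddCommGroup M'] [Module A M'] {N : Submodule A M}
    (hN : IsEssential N) (f : M' →ₗ[A] M) : IsEssential (N.comap f) := by
  intro L h
  have h1 : L.map f = ⊥ := by
    apply hN
    rw [eq_bot_iff]
    rintro _ ⟨hy, x, hx, rfl⟩
    have hxb : x ∈ N.comap f ⊓ L := ⟨hy, hx⟩
    rw [h, Submodule.mem_bot] at hxb
    simp [hxb]
  rw [eq_bot_iff, ← h]
  intro x hx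
  refine ⟨?_, hx⟩
  have hfx : f x ∈ L.map f := Submodule.mem_map_of_mem hx
  rw [h1, Submodule.mem_bot] at hfx
  simp [hfx]

end Essential

variable (R : Type u) [Ring R] (M : Type v) [AddCommGroup M] [Module Rᵐᵒᵖ M]

/-- Left multiplication by `r`, an endomorphism of the right module `R`. -/
def lmul (r : R) : R →ₗ[Rᵐᵒᵖ] R where
  toFun a := r * a
  map_add' := mul_add r
  map_smul' c a := by simp [MulOpposite.smul_eq_mul_unop, mul_assoc]

/-- The singular submodule `Z(M)` of a right `R`-module `M`: all `m` with `m I = 0` for some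
essential right ideal `I` of `R`. -/
def singularSubmodule : Submodule Rᵐᵒᵖ M where
  carrier := {m | ∃ I : Submodule Rᵐᵒᵖ R, IsEssential I ∧ ∀ a ∈ I, MulOpposite.op a • m = 0}
  zero_mem' := ⟨⊤, isEssential_top, fun _ _ => smul_zero _⟩
  add_mem' := by
    rintro m n ⟨I, hI, hm⟩ ⟨J, hJ, hn⟩
    exact ⟨I ⊓ J, hI.inf hJ, fun a ha => by rw [smul_add, hm a ha.1, hn a ha.2, add_zero]⟩
  smul_mem' := by
    rintro c m ⟨I, hI, hm⟩
    refine ⟨I.comap (lmul R c.unop), hI.comap _, fun a ha => ?_⟩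
    have h := hm (c.unop * a) ha
    rwa [MulOpposite.op_mul, MulOpposite.op_unop, mul_smul] at h

/-- The Goldie torsion (second singular) submodule `Z₂(M)`: the submodule containing `Z(M)` with
`Z₂(M) / Z(M) = Z(M / Z(M))`. -/
def goldieTorsion : Submodule Rᵐᵒᵖ M :=
  (singularSubmodule R (M ⧸ singularSubmodule R M)).comap (singularSubmodule R M).mkQ

/-- `M` is Goldie Rickart if `f⁻¹(Z₂(M))` is a direct summand of `M` for every endomorphism `f`
of `M`. -/
def IsGoldieRickart : Prop :=
  ∀ f : M →ₗ[Rᵐᵒᵖ] M, ∃ K : Submodule Rᵐᵒᵖ M, IsCompl ((goldieTorsion R M).comap f) K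

end GoldieRickart

/-!
A semisimple ring has only semisimple and projective right modules, so the first condition follows
from the second.

Conversely, only the projectivity of the Goldie torsion submodules is needed. If `E` is an
essential right ideal, then `R ⧸ E` is singular, hence equal to its own Goldie torsion submodule,
hence projective. So `R → R ⧸ E` splits (`eq_top_of_projective_quotient`), and an essential direct
summand is everything: `E = R`. Since every right ideal `I` has a `J` with `I ⊓ J = 0` and `I ⊔ J`
essential (`exists_disjoint_isEssential_sup`), every right ideal is a direct summand of `R`.
-/

namespace GoldieRickart

section Essential

variable {A : Type u} [Ring A] {M : Type v} [AddCommGroup M] [Module A M]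

/-- Every submodule has a complement up to essential extension. By Zorn's lemma there is a maximal
submodule disjoint from `N`; its sum with `N` is essential. -/
theorem exists_disjoint_isEssential_sup (N : Submodule A M) :
    ∃ K : Submodule A M, Disjoint N K ∧ IsEssential (N ⊔ K) := by
  obtain ⟨K, -, hK⟩ := zorn_le_nonempty₀ {K : Submodule A M | Disjoint N K}
    (fun c hc hchain _ _ => ⟨sSup c,
      hchain.directedOn.disjoint_sSup_right.2 fun b hb => hc hb, fun _ => le_sSup⟩)
    ⊥ disjoint_bot_right
  refine ⟨K, hK.prop, fun L hL => ?_⟩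
  have hNKL : Disjoint N (K ⊔ L) := hK.prop.disjoint_sup_right_of_disjoint_sup_left
    (disjoint_iff.2 hL)
  have hLK : L ≤ K := le_sup_right.trans (hK.le_of_ge hNKL le_sup_left)
  rwa [inf_eq_right.2 (hLK.trans le_sup_right)] at hL

theorem IsEssential.eq_top_of_projective_quotient {E : Submodule A M} (hE : IsEssential E)
    [Module.Projective A (M ⧸ E)] : E = ⊤ := by
  obtain ⟨g, hg⟩ := E.mkQ.exists_rightInverse_of_surjective E.range_mkQ
  have hgx (x : M ⧸ E) : E.mkQ (g x) = x := LinearMap.congr_fun hg x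
  have hrange : LinearMap.range g = ⊥ := by
    apply hE
    rw [eq_bot_iff]
    rintro _ ⟨hx, x, rfl⟩
    have h : x = 0 := by rw [← hgx x, Submodule.mkQ_apply, Submodule.Quotient.mk_eq_zero]; exact hx
    simp [h]
  rw [LinearMap.range_eq_bot] at hrange
  rw [← E.ker_mkQ, LinearMap.ker_eq_top]
  ext x
  simpa [hrange] using (hgx (E.mkQ x)).symm

end Essential

section Torsion

variable {R : Type u} [Ring R] {M : Type v} [AddCommGroup M] [Module Rᵐᵒᵖ M]

theorem singularSubmodule_le_goldieTorsion : singularSubmodule R M ≤ goldieTorsion R M := by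
  intro m hm
  have h : (singularSubmodule R M).mkQ m = 0 := by simpa using hm
  rw [goldieTorsion, Submodule.mem_comap, h]
  exact zero_mem _

theorem singularSubmodule_eq_top_of_equiv_quotient {E : Submodule Rᵐᵒᵖ R} (hE : IsEssential E)
    (e : M ≃ₗ[Rᵐᵒᵖ] R ⧸ E) : singularSubmodule R M = ⊤ := by
  rw [eq_top_iff]
  intro m _
  obtain ⟨r, hr⟩ := E.mkQ_surjective (e m)
  -- The class of `r` is annihilated by the essential right ideal `{a | r * a ∈ E}`.
  refine ⟨E.comap (lmul R r), hE.comap _, fun a ha => e.injective ?_⟩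
  rw [map_smul, ← hr, ← map_smul, map_zero]
  simpa [lmul] using ha

end Torsion

/-- A ring is semisimple once it is semisimple as a right module over itself. -/
theorem isSemisimpleRing_of_isSemisimpleModule_mulOpposite {R : Type u} [Ring R]
    [IsSemisimpleModule Rᵐᵒᵖ R] : IsSemisimpleRing R := by
  let e : R ≃ₗ[Rᵐᵒᵖ] Rᵐᵒᵖ :=
    { MulOpposite.opAddEquiv with map_smul' := fun _ _ => rfl }
  exact isSemisimpleRing_mulOpposite_iff.1 (IsSemisimpleModule.congr e.symm)

end GoldieRickart

open GoldieRickart in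
theorem theorem2p17 (R : Type u) [Ring R] :
    (∀ (M : Type (max u v)) [AddCommGroup M] [Module Rᵐᵒᵖ M],
        GoldieRickart.IsGoldieRickart R M ∧
          Module.Projective Rᵐᵒᵖ (GoldieRickart.goldieTorsion R M)) ↔
      IsSemisimpleRing R := by
  constructor
  · intro h
    have htop (E : Submodule Rᵐᵒᵖ R) (hE : IsEssential E) : E = ⊤ := by
      -- The hypothesis speaks of modules in `Type (max u v)`, so `R ⧸ E` is lifted there.
      let e : ULift.{v} (R ⧸ E) ≃ₗ[Rᵐᵒᵖ] R ⧸ E := ULift.moduleEquiv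
      have hZ : goldieTorsion R (ULift.{v} (R ⧸ E)) = ⊤ := top_le_iff.1 <|
        (singularSubmodule_eq_top_of_equiv_quotient hE e).ge.trans
          singularSubmodule_le_goldieTorsion
      have := (h (ULift.{v} (R ⧸ E))).2
      have : Module.Projective Rᵐᵒᵖ (R ⧸ E) :=
        .of_equiv ((LinearEquiv.ofTop _ hZ).trans e)
      exact hE.eq_top_of_projective_quotient
    have : ComplementedLattice (Submodule Rᵐᵒᵖ R) := by
      refine ⟨fun I => ?_⟩
      obtain ⟨J, hIJ, hE⟩ := exists_disjoint_isEssential_sup I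
      exact ⟨J, hIJ, codisjoint_iff.2 (htop _ hE)⟩
    have : IsSemisimpleModule Rᵐᵒᵖ R := ⟨⟩
    exact isSemisimpleRing_of_isSemisimpleModule_mulOpposite
  · intro _ M _ _
    exact ⟨fun f => exists_isCompl _, Module.projective_of_isSemisimpleRing _ _⟩
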